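/- Let $n\ge 0$, let $W$ be the space of complex $n\times n$ matrices with the quadratic form $Q(A)=\operatorname{trace}(AA^T)$, and let $O(W,Q)\subset GL(W)$ be its orthogonal group. Let $S^kW$ denote the space of homogeneous polynomials of degree $k$ in the $n^2$ matrix entries, with $O(W,Q)$ acting by $(g\cdot P)(A)=P(g^{-1}A)$, let $\det_n\in S^nW$ be the determinant, and let $X_n=\overline{O(W,Q)\cdot[\det_n]}\subset\mathbb P(S^nW)$ be the Zariski closure of the orbit of $[\det_n]$. For $P\in S^nW$ let $H(P)$ be its Hessian, i.e. the matrix of second partial derivatives of $P$ with respect to the matrix entries, regarded through the identification $W\cong W^*$ given by $Q$ as an endomorphism of $W$ with polynomial coefficients, and let $\operatorname{trace}(H(P)^{\wedge j})$ be the trace of the induced endomorphism of $\Lambda^jW$ (up to sign, a coefficient of the characteristic polynomial of $H(P)$). Let $j$ be an odd integer with $1<j\le 2n+1$. (1) For every $P\in S^nW$ the polynomial $\operatorname{trace}(H(P)^{\wedge j})$ is homogeneous of degree $j(n-2)$ (for $n=1$ it is zero). (2) If $[P]\in X_n$, then $P$ divides $\operatorname{trace}(H(P)^{\wedge j})$.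 (3) If $n\ge 2$, there is a nonzero $O(W,Q)$-submodule $M$ of the space $S^{(j-1)(n-1)}\big((S^nW)^*\big)$ of homogeneous polynomials of degree $(j-1)(n-1)$ on $S^nW$, all of whose elements vanish on $X_n$. If $n\ge 3$, $M$ can moreover be chosen so that its elements vanish at every $P\in S^nW$ that divides $\operatorname{trace}(H(P)^{\wedge j})$, so that they are consequences of the divisibility in (2). -/

import Mathlib

open scoped LinearAlgebra.Projectivization

noncomputable section

/-! ### Polynomial functions on a complex vector space and the Zariski closure in `ℙ V` -/

/-- The linear forms on `V`, inside the ring of all functions `V → ℂ`. -/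
def linearForms (V : Type*) [AddCommGroup V] [Module ℂ V] : Submodule ℂ (V → ℂ) :=
  LinearMap.range (LinearMap.ltoFun ℂ V ℂ ℂ)

/-- `S^k V^*`, the homogeneous polynomial functions of degree `k` on `V`: the span of the
products of `k` linear forms. -/
def polyForms (V : Type*) [AddCommGroup V] [Module ℂ V] (k : ℕ) : Submodule ℂ (V → ℂ) :=
  linearForms V ^ k

/-- The Zariski closure of a subset of projective space: the points at which every homogeneous
polynomial vanishing on (the cone over) the subset vanishes. -/
def zariskiClosure {V : Type*} [AddCommGroup V] [Module ℂ V] (Z : Set (ℙ ℂ V)) :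
    Set (ℙ ℂ V) :=
  {p | ∀ (k : ℕ), ∀ F ∈ polyForms V k,
    (∀ (v : V) (hv : v ≠ 0), Projectivization.mk ℂ v hv ∈ Z → F v = 0) →
    ∀ (v : V) (hv : v ≠ 0), Projectivization.mk ℂ v hv = p → F v = 0}

/-! ### The space `W` of matrices, its quadratic form and its orthogonal group -/

/-- `W`, the space of complex `n × n` matrices. -/
abbrev MatW (n : ℕ) : Type := Matrix (Fin n) (Fin n) ℂ

/-- The quadratic form `Q(A) = trace (A Aᵀ)`. -/
def traceQ (n : ℕ) (A : MatW n) : ℂ := (A * A.transpose).trace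

/-- The orthogonal group `O(W, Q)`. -/
def orthW (n : ℕ) : Subgroup (MatW n ≃ₗ[ℂ] MatW n) where
  carrier := {g | ∀ A, traceQ n (g A) = traceQ n A}
  one_mem' := fun _ => rfl
  mul_mem' := fun {a b} ha hb A => (ha (b A)).trans (hb A)
  inv_mem' := fun {a} ha A => by
    have h := ha (a.symm A)
    rw [a.apply_symm_apply] at h
    exact h.symm

/-! ### Polynomials in the matrix entries -/

/-- Polynomials in the `n²` matrix entries. -/
abbrev PolyW (n : ℕ) : Type := MvPolynomial (Fin n × Fin n) ℂ

/-- `S^n W`, the homogeneous polynomials of degree `n` in the `n²` matrix entries. -/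
abbrev SymW (n : ℕ) : Submodule ℂ (PolyW n) :=
  MvPolynomial.homogeneousSubmodule (Fin n × Fin n) ℂ n

/-- The value of a polynomial at a matrix. -/
def evalMat {n : ℕ} (A : MatW n) (P : PolyW n) : ℂ :=
  MvPolynomial.eval (fun a => A a.1 a.2) P

/-- Composition of a polynomial with a linear map `g : W → W`. -/
def compLin {n : ℕ} (g : MatW n →ₗ[ℂ] MatW n) : PolyW n →ₐ[ℂ] PolyW n :=
  MvPolynomial.aeval fun a =>
    ∑ b : Fin n × Fin n,
      MvPolynomial.C (g (Matrix.single b.1 b.2 1) a.1 a.2) * MvPolynomial.X b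

lemma evalMat_compLin {n : ℕ} (g : MatW n →ₗ[ℂ] MatW n) (P : PolyW n) (A : MatW n) :
    evalMat A (compLin g P) = evalMat (g A) P := by
  have hA : g A = ∑ b : Fin n × Fin n, A b.1 b.2 • g (Matrix.single b.1 b.2 1) := by
    conv_lhs => rw [Matrix.matrix_eq_sum_single A]
    rw [Fintype.sum_prod_type, map_sum]
    refine Finset.sum_congr rfl fun i _ => ?_
    rw [map_sum]
    refine Finset.sum_congr rfl fun j _ => ?_
    rw [← map_smul, Matrix.smul_single, smul_eq_mul, mul_one]
  unfold evalMat compLin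
  rw [MvPolynomial.map_aeval, MvPolynomial.eval, hA]
  congr 1
  · congr 1
    · ext a
      simp
    · funext a
      simp [Matrix.sum_apply, mul_comm]

lemma polyW_ext {n : ℕ} {P R : PolyW n} (h : ∀ A, evalMat A P = evalMat A R) : P = R :=
  MvPolynomial.funext fun x => h (Matrix.of fun i j => x (i, j))

lemma compLin_mem {n : ℕ} (g : MatW n →ₗ[ℂ] MatW n) {P : PolyW n} (hP : P ∈ SymW n) :
    compLin g P ∈ SymW n := by
  have h := MvPolynomial.IsHomogeneous.aeval (S := ℂ) (n := 1)
    (g := fun a : Fin n × Fin n => ∑ b : Fin n × Fin n,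
      MvPolynomial.C (σ := Fin n × Fin n) (g (Matrix.single b.1 b.2 1) a.1 a.2) *
        MvPolynomial.X b)
    ((MvPolynomial.mem_homogeneousSubmodule n P).1 hP)
    (fun a => MvPolynomial.IsHomogeneous.sum _ _ _ fun b _ =>
      MvPolynomial.isHomogeneous_C_mul_X _ _)
  rw [one_mul] at h
  exact (MvPolynomial.mem_homogeneousSubmodule n _).2 h

/-- The action of `O(W, Q)` on `S^n W`: `(g · P)(A) = P(g⁻¹ A)`. -/
def symRep (n : ℕ) : Representation ℂ (orthW n) (SymW n) where
  toFun g := (compLin ((g⁻¹ : orthW n) : MatW n ≃ₗ[ℂ] MatW n).toLinearMap).toLinearMap.restrict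
    fun _ hP => compLin_mem _ hP
  map_one' := by
    ext1 P
    apply Subtype.ext
    apply polyW_ext
    intro A
    exact evalMat_compLin _ _ _
  map_mul' a b := by
    ext1 P
    apply Subtype.ext
    apply polyW_ext
    intro A
    refine (evalMat_compLin _ _ _).trans ?_
    refine Eq.trans ?_ (evalMat_compLin _ _ _).symm
    refine Eq.trans ?_ (evalMat_compLin _ _ _).symm
    rw [mul_inv_rev]
    rfl

lemma evalMat_symRep {n : ℕ} (g : orthW n) (P : SymW n) (A : MatW n) :
    evalMat A (symRep n g P : PolyW n) =
      evalMat ((g : MatW n ≃ₗ[ℂ] MatW n).symm A) (P : PolyW n) :=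
  evalMat_compLin _ _ _

/-- The determinant polynomial `det_n ∈ S^n W`. -/
def detPoly (n : ℕ) : SymW n :=
  ⟨(Matrix.mvPolynomialX (Fin n) (Fin n) ℂ).det, by
    rw [MvPolynomial.mem_homogeneousSubmodule, Matrix.det_apply]
    refine MvPolynomial.IsHomogeneous.sum _ _ _ fun σ _ => ?_
    have h := MvPolynomial.IsHomogeneous.prod Finset.univ
      (fun i => Matrix.mvPolynomialX (Fin n) (Fin n) ℂ (σ i) i) (fun _ => 1)
      (fun i _ => MvPolynomial.isHomogeneous_X ℂ (σ i, i))
    simp only [Finset.sum_const, Finset.card_univ, Fintype.card_fin, smul_eq_mul,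
      mul_one] at h
    rcases Int.units_eq_one_or (Equiv.Perm.sign σ) with hs | hs
    · rw [hs, one_smul]
      exact h
    · rw [hs, Units.neg_smul, one_smul]
      exact h.neg⟩

lemma detPoly_ne_zero (n : ℕ) : detPoly n ≠ 0 := fun h =>
  Matrix.det_mvPolynomialX_ne_zero (Fin n) ℂ (congrArg Subtype.val h)

lemma symRep_detPoly_ne_zero {n : ℕ} (g : orthW n) : symRep n g (detPoly n) ≠ 0 := by
  intro h
  apply detPoly_ne_zero n
  have h2 := congrArg (symRep n g⁻¹) h
  rwa [map_zero, ← Module.End.mul_apply, ← map_mul, inv_mul_cancel, map_one] at h2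

/-- The closure in `ℙ (S^n W)` of the orbit `O(W, Q) · [det_n]`. -/
def detOrbitClosure (n : ℕ) : Set (ℙ ℂ (SymW n)) :=
  zariskiClosure (Set.range fun g : orthW n =>
    Projectivization.mk ℂ (symRep n g (detPoly n)) (symRep_detPoly_ne_zero g))

/-! ### The Hessian -/

/-- The Hessian `H(P) ∈ S²W ⊗ S^{d-2}W`, as an endomorphism of `W` with polynomial coefficients,
through the identification of `W` with `W^*` given by `Q` (see `trace_hessEnd_mul_transpose`). -/
def hessEnd {n : ℕ} (P : PolyW n) :
    Matrix (Fin n) (Fin n) (PolyW n) →ₗ[PolyW n] Matrix (Fin n) (Fin n) (PolyW n) where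
  toFun A := Matrix.of fun i j =>
    ∑ b : Fin n × Fin n, MvPolynomial.pderiv (i, j) (MvPolynomial.pderiv b P) * A b.1 b.2
  map_add' A B := by
    ext1 i j
    simp [mul_add, Finset.sum_add_distrib]
  map_smul' c A := by
    ext1 i j
    simp [Finset.mul_sum, mul_left_comm]

/-- Under the bilinear form `(A, B) ↦ trace (A Bᵀ)` of `Q`, the endomorphism `hessEnd P` is the
bilinear form given by the matrix of second partial derivatives of `P`. -/
lemma trace_hessEnd_mul_transpose {n : ℕ} (P : PolyW n)
    (A B : Matrix (Fin n) (Fin n) (PolyW n)) :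
    (hessEnd P A * B.transpose).trace =
      ∑ a : Fin n × Fin n, ∑ b : Fin n × Fin n,
        MvPolynomial.pderiv a (MvPolynomial.pderiv b P) * A b.1 b.2 * B a.1 a.2 := by
  rw [Fintype.sum_prod_type]
  simp [Matrix.trace, Matrix.mul_apply, hessEnd, Finset.sum_mul]

/-- `trace (H(P)^{∧ j})`, the trace of the map that `H(P)` induces on the `j`-th exterior power
of `W`; a polynomial in the matrix entries. -/
def hessTrace {n : ℕ} (j : ℕ) (P : PolyW n) : PolyW n :=
  LinearMap.trace (PolyW n) (⋀[PolyW n]^j (Matrix (Fin n) (Fin n) (PolyW n)))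
    (exteriorPower.map j (hessEnd P))

end

/-! ### Traces of exterior powers -/

/-! Write `R_j(P)` for `trace (H(P)^{∧ j})`. It commutes with orthogonal changes of coordinates and
satisfies `R_j(cP) = c^j R_j(P)`. If `yA = 0` with `y ⬝ᵥ y ≠ 0`, left multiplication by the
reflection along `y` is orthogonal on `W`, fixes `A` and turns `det` into `-det`; so for odd `j` the
value of `R_j(det)` at `A` equals its own negative (`evalMat_hessTrace_det`). To turn this vanishing
into divisibility, `y` is taken to be row `k` of the generic adjugate. With `q_k = y ⬝ᵥ y`, this
shows that `det` divides a power of `q_k` times `R_j(det)` (`detPoly_dvd_dotProduct_pow_mul`). Since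
`q_k` does not involve column `k`, these powers have no common factor, and `det` divides `R_j(det)`.

The condition `P ∣ R_j(P)` is invariant under `O(W, Q)`, and on nonzero `P` it is cut out by forms:
the coefficients of the pseudo-remainder of `R_j(P)` by `P` on all lines (`remForm_eq_zero_of_dvd`,
`dvd_hessTrace_of_remForm_eq_zero`). Hence it passes to the orbit closure. For `n ≥ 3` these forms
have degree `j + (j(n-2) + 1 - n) = (j-1)(n-1)` and are themselves the required equations; they are
not all zero because a sum of `j` pure `n`-th powers violates the divisibility. For `n = 2` that
count of steps is negative, and powers of the Laplacian, the case `j = 1`, serve instead. -/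

/-- The trace of the endomorphism induced on the `j`-th exterior power is the sum of the principal
minors of size `j`. -/
lemma trace_exteriorPower_map {R M ι : Type*} [CommRing R] [AddCommGroup M] [Module R M]
    [Fintype ι] [DecidableEq ι] (b : Module.Basis ι R M) (j : ℕ) (f : M →ₗ[R] M) :
    LinearMap.trace R (⋀[R]^j M) (exteriorPower.map j f) =
      ∑ s ∈ Finset.univ.powersetCard j,
        ((LinearMap.toMatrix b b f).submatrix (Subtype.val : s → ι) Subtype.val).det := by
  classical
  -- The order only serves to pick the basis of wedge products indexed by `j`-subsets; the diagonal
  -- entries in that basis are the principal minors.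
  let : LinearOrder ι := linearOrderOfSTO WellOrderingRel
  have : Fintype (Set.powersetCard ι j) := Fintype.ofFinite _
  rw [LinearMap.trace_eq_matrix_trace R (b.exteriorPower j), Matrix.trace]
  refine Finset.sum_bij (fun s _ => s.1) (fun s _ => ?_) (fun s _ t _ h => Subtype.ext h)
    (fun s hs => ⟨⟨s, (Finset.mem_powersetCard.1 hs).2⟩, Finset.mem_univ _, rfl⟩) (fun s _ => ?_)
  · exact Finset.mem_powersetCard.2 ⟨Finset.subset_univ _, s.2⟩
  · rw [Matrix.diag_apply, LinearMap.toMatrix_apply, exteriorPower.basis_apply,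
      exteriorPower.map_apply_ιMulti_family, exteriorPower.basis_repr_apply,
      exteriorPower.ιMulti_family, exteriorPower.ιMultiDual_apply_ιMulti, ← Matrix.det_transpose]
    rw [← Matrix.det_submatrix_equiv_self (Finset.orderIsoOfFin s.1 s.2).toEquiv]
    congr 1
    ext i k
    simp [LinearMap.toMatrix_apply, Set.powersetCard.ofFinEmbEquiv_symm_apply]
    rfl

/-! ### The Hessian matrix -/

/-- The matrix of second partial derivatives. -/
noncomputable def hessMat {n : ℕ} (P : PolyW n) : Matrix (Fin n × Fin n) (Fin n × Fin n) (PolyW n) :=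
  Matrix.of fun a b => MvPolynomial.pderiv a (MvPolynomial.pderiv b P)

lemma hessMat_apply {n : ℕ} (P : PolyW n) (a b : Fin n × Fin n) :
    hessMat P a b = MvPolynomial.pderiv a (MvPolynomial.pderiv b P) := rfl

lemma hessTrace_eq_sum_minors {n : ℕ} (j : ℕ) (P : PolyW n) :
    hessTrace j P = ∑ s ∈ Finset.univ.powersetCard j,
      ((hessMat P).submatrix (Subtype.val : s → Fin n × Fin n) Subtype.val).det := by
  have h : LinearMap.toMatrix (Matrix.stdBasis (PolyW n) (Fin n) (Fin n))
      (Matrix.stdBasis (PolyW n) (Fin n) (Fin n)) (hessEnd P) = hessMat P := by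
    ext1 ⟨a, a'⟩ ⟨b, b'⟩
    rw [LinearMap.toMatrix_apply, Matrix.stdBasis_eq_single, hessMat_apply]
    rw [show (Matrix.stdBasis (PolyW n) (Fin n) (Fin n)).repr
      (hessEnd P (Matrix.single b b' 1)) (a, a') = hessEnd P (Matrix.single b b' 1) a a' from rfl]
    simp only [hessEnd, LinearMap.coe_mk, AddHom.coe_mk, Matrix.of_apply]
    rw [Finset.sum_eq_single (b, b')]
    · simp
    · rintro ⟨c, c'⟩ - hc
      rw [Matrix.single_apply_of_ne, mul_zero]
      rintro ⟨rfl, rfl⟩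
      exact hc rfl
    · simp
  rw [hessTrace, trace_exteriorPower_map (Matrix.stdBasis (PolyW n) (Fin n) (Fin n)), h]

/-- In this form the invariance under orthogonal conjugation follows from `det (1 + AB) = det (1 +
BA)`. -/
lemma hessTrace_eq_coeff {n : ℕ} (j : ℕ) (P : PolyW n) :
    hessTrace j P =
      (1 + (Polynomial.X : Polynomial (PolyW n)) • (hessMat P).map Polynomial.C).det.coeff j := by
  rw [hessTrace_eq_sum_minors, Matrix.coeff_det_one_add_X_smul_eq_sum_minors]

lemma hessTrace_isHomogeneous {n : ℕ} (j d : ℕ) {P : PolyW n} (hP : P.IsHomogeneous d) :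
    (hessTrace j P).IsHomogeneous (j * (d - 2)) := by
  rw [hessTrace_eq_sum_minors]
  refine MvPolynomial.IsHomogeneous.sum _ _ _ fun s hs => ?_
  rw [Matrix.det_apply]
  refine MvPolynomial.IsHomogeneous.sum _ _ _ fun σ _ => ?_
  have h := MvPolynomial.IsHomogeneous.prod Finset.univ
    (fun i => (hessMat P).submatrix (Subtype.val : s → Fin n × Fin n) Subtype.val (σ i) i)
    (fun _ => d - 1 - 1) (fun i _ => hP.pderiv.pderiv)
  rw [Finset.sum_const, Finset.card_univ, Fintype.card_coe, (Finset.mem_powersetCard.1 hs).2,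
    smul_eq_mul, Nat.sub_sub] at h
  rcases Int.units_eq_one_or (Equiv.Perm.sign σ) with hs | hs
  · rw [hs, one_smul]
    exact h
  · rw [hs, Units.neg_smul, one_smul]
    exact h.neg

lemma hessTrace_C_mul {n : ℕ} (j : ℕ) (c : ℂ) (P : PolyW n) :
    hessTrace j (MvPolynomial.C c * P) = MvPolynomial.C (c ^ j) * hessTrace j P := by
  have h : hessMat (MvPolynomial.C c * P) =
      (MvPolynomial.C c : PolyW n) • hessMat P := by
    ext1 a b
    simp [hessMat_apply]
  rw [hessTrace_eq_sum_minors, hessTrace_eq_sum_minors, h, Finset.mul_sum]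
  refine Finset.sum_congr rfl fun s hs => ?_
  change ((MvPolynomial.C c : PolyW n) •
    (hessMat P).submatrix (Subtype.val : s → Fin n × Fin n) Subtype.val).det = _
  rw [Matrix.det_smul, Fintype.card_coe, (Finset.mem_powersetCard.1 hs).2, map_pow]

/-! ### Equivariance under the orthogonal group -/

/-- The matrix of a linear endomorphism of `W` in the basis of matrix units. -/
noncomputable def linMat {n : ℕ} (g : MatW n →ₗ[ℂ] MatW n) : Matrix (Fin n × Fin n) (Fin n × Fin n) ℂ :=
  Matrix.of fun a b => g (Matrix.single b.1 b.2 1) a.1 a.2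

lemma compLin_X {n : ℕ} (g : MatW n →ₗ[ℂ] MatW n) (a : Fin n × Fin n) :
    compLin g (MvPolynomial.X a) =
      ∑ b, MvPolynomial.C (linMat g a b) * MvPolynomial.X b := by
  simp [compLin, linMat]

lemma pderiv_compLin {n : ℕ} (g : MatW n →ₗ[ℂ] MatW n) (P : PolyW n) (c : Fin n × Fin n) :
    MvPolynomial.pderiv c (compLin g P) =
      ∑ a, MvPolynomial.C (linMat g a c) * compLin g (MvPolynomial.pderiv a P) := by
  induction P using MvPolynomial.induction_on with
  | C r => simp [compLin]
  | add P R hP hR => simp only [map_add, hP, hR, mul_add, Finset.sum_add_distrib]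
  | mul_X P b hP =>
    have hX : MvPolynomial.pderiv c (compLin g (MvPolynomial.X b)) =
        MvPolynomial.C (linMat g b c) := by
      rw [compLin_X, map_sum, Finset.sum_eq_single c]
      · simp
      · intro a _ ha
        rw [MvPolynomial.pderiv_C_mul, MvPolynomial.pderiv_X_of_ne ha, mul_zero]
      · simp
    have hY : ∀ a, compLin g (MvPolynomial.pderiv a (P * MvPolynomial.X b)) =
        compLin g (MvPolynomial.pderiv a P) * compLin g (MvPolynomial.X b) +
          compLin g P * (if a = b then 1 else 0) := by
      intro a
      rw [MvPolynomial.pderiv_mul, map_add, map_mul, map_mul]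
      congr 2
      split_ifs with h
      · rw [h, MvPolynomial.pderiv_X_self, map_one]
      · rw [MvPolynomial.pderiv_X_of_ne (Ne.symm h), map_zero]
    rw [map_mul, MvPolynomial.pderiv_mul, hX, hP]
    simp only [hY, mul_add, Finset.sum_add_distrib, Finset.sum_mul, mul_assoc]
    congr 1
    rw [Finset.sum_eq_single b]
    · simp [mul_comm]
    · intro a _ ha
      simp [ha]
    · simp

lemma hessMat_compLin {n : ℕ} (g : MatW n →ₗ[ℂ] MatW n) (P : PolyW n) :
    hessMat (compLin g P) =
      ((linMat g).map MvPolynomial.C).transpose * (hessMat P).map (compLin g) *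
        (linMat g).map MvPolynomial.C := by
  ext1 a b
  simp only [hessMat_apply, pderiv_compLin, map_sum, MvPolynomial.pderiv_C_mul, Matrix.mul_apply,
    Matrix.map_apply, Matrix.transpose_apply, Finset.mul_sum, Finset.sum_mul]
  refine Finset.sum_congr rfl fun c _ => Finset.sum_congr rfl fun d _ => ?_
  ring

lemma traceQ_eq_sum {n : ℕ} (A : MatW n) : traceQ n A = ∑ a : Fin n × Fin n, A a.1 a.2 ^ 2 := by
  simp [traceQ, Matrix.trace, Matrix.mul_apply, Fintype.sum_prod_type, sq]

/-- Polarisation of `Q`, whose matrix in the basis of matrix units is the identity. -/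
lemma linMat_transpose_mul_self {n : ℕ} {g : MatW n →ₗ[ℂ] MatW n}
    (hg : ∀ A, traceQ n (g A) = traceQ n A) : (linMat g).transpose * linMat g = 1 := by
  have hpol : ∀ A B : MatW n, ∑ a : Fin n × Fin n, g A a.1 a.2 * g B a.1 a.2 =
      ∑ a : Fin n × Fin n, A a.1 a.2 * B a.1 a.2 := by
    intro A B
    have h := hg (A + B)
    have hA := hg A
    have hB := hg B
    rw [map_add] at h
    simp only [traceQ_eq_sum, Matrix.add_apply, add_sq, Finset.sum_add_distrib, mul_assoc,
      ← Finset.mul_sum] at h hA hB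
    rw [hA, hB] at h
    exact mul_left_cancel₀ two_ne_zero (add_left_cancel (add_right_cancel h))
  ext1 a b
  simp only [Matrix.mul_apply, Matrix.transpose_apply, linMat, Matrix.of_apply, hpol]
  rw [Finset.sum_eq_single a]
  · rw [Matrix.single_apply_same, one_mul, Matrix.single_apply, Matrix.one_apply]
    simp only [Prod.ext_iff, eq_comm]
  · intro c _ hc
    rw [Matrix.single_apply_of_ne, zero_mul]
    rintro ⟨h, h'⟩
    exact hc (Prod.ext h.symm h'.symm)
  · simp

/-- `P ↦ trace (H(P)^{∧ j})` commutes with orthogonal changes of coordinates. -/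
lemma hessTrace_compLin {n : ℕ} (j : ℕ) {g : MatW n →ₗ[ℂ] MatW n}
    (hg : ∀ A, traceQ n (g A) = traceQ n A) (P : PolyW n) :
    hessTrace j (compLin g P) = compLin g (hessTrace j P) := by
  have hG : (linMat g).map MvPolynomial.C * ((linMat g).map MvPolynomial.C).transpose =
      (1 : Matrix (Fin n × Fin n) (Fin n × Fin n) (PolyW n)) := by
    rw [← Matrix.transpose_map, ← Matrix.map_mul, mul_eq_one_comm.1 (linMat_transpose_mul_self hg)]
    exact Matrix.map_one _ (map_zero _) (map_one _)
  set G := (linMat g).map (MvPolynomial.C (σ := Fin n × Fin n)) with hGdef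
  set N := (hessMat P).map (compLin g) with hN
  have h1 : hessTrace j (compLin g P) =
      (1 + (Polynomial.X : Polynomial (PolyW n)) • N.map Polynomial.C).det.coeff j := by
    -- The right-hand factor `G` is moved cyclically to the left of the product, where it meets `Gᵀ`
    -- and cancels.
    rw [hessTrace_eq_coeff, hessMat_compLin, ← hGdef, ← hN, Matrix.mul_assoc, Matrix.map_mul,
      ← Matrix.mul_smul, Matrix.det_one_add_mul_comm, Matrix.smul_mul, ← Matrix.map_mul,
      Matrix.mul_assoc, hG, Matrix.mul_one]
  rw [h1, Matrix.coeff_det_one_add_X_smul_eq_sum_minors, hessTrace_eq_sum_minors, map_sum]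
  refine Finset.sum_congr rfl fun s _ => ?_
  rw [AlgHom.map_det]
  rfl

/-! ### The determinant divides the odd traces of its Hessian -/

/-- The orthogonal reflection in the hyperplane perpendicular to `y`. -/
noncomputable def reflMat {n : ℕ} (y : Fin n → ℂ) : MatW n :=
  1 - Matrix.vecMulVec ((2 / (y ⬝ᵥ y)) • y) y

lemma reflMat_transpose {n : ℕ} (y : Fin n → ℂ) : (reflMat y).transpose = reflMat y := by
  rw [reflMat, Matrix.transpose_sub, Matrix.transpose_one, Matrix.transpose_vecMulVec,
    Matrix.vecMulVec_smul, Matrix.smul_vecMulVec]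

lemma reflMat_mul_self {n : ℕ} {y : Fin n → ℂ} (hy : y ⬝ᵥ y ≠ 0) : reflMat y * reflMat y = 1 := by
  have h : 2 / (y ⬝ᵥ y) * (2 / (y ⬝ᵥ y) * (y ⬝ᵥ y)) = 2 / (y ⬝ᵥ y) + 2 / (y ⬝ᵥ y) := by
    field_simp
    norm_num
  simp only [reflMat, Matrix.smul_vecMulVec, sub_mul, mul_sub, one_mul, mul_one,
    Matrix.smul_mul, Matrix.mul_smul, Matrix.vecMulVec_mul_vecMulVec, Matrix.vecMulVec_smul,
    smul_smul, h, add_smul]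
  abel

lemma det_reflMat {n : ℕ} {y : Fin n → ℂ} (hy : y ⬝ᵥ y ≠ 0) : (reflMat y).det = -1 := by
  rw [reflMat, Matrix.vecMulVec_eq Unit, Matrix.det_one_sub_mul_comm, Matrix.det_unique]
  simp [Matrix.replicateRow_mul_replicateCol_apply, hy]
  norm_num

lemma reflMat_mul {n : ℕ} {y : Fin n → ℂ} {A : MatW n} (hA : Matrix.vecMul y A = 0) :
    reflMat y * A = A := by
  rw [reflMat, sub_mul, one_mul, Matrix.vecMulVec_mul, hA, Matrix.vecMulVec_zero, sub_zero]

lemma traceQ_reflMat_mul {n : ℕ} {y : Fin n → ℂ} (hy : y ⬝ᵥ y ≠ 0) (A : MatW n) :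
    traceQ n (LinearMap.mulLeft ℂ (reflMat y) A) = traceQ n A := by
  rw [LinearMap.mulLeft_apply, traceQ, Matrix.transpose_mul, Matrix.mul_assoc,
    Matrix.trace_mul_comm, reflMat_transpose, Matrix.mul_assoc, Matrix.mul_assoc,
    reflMat_mul_self hy, Matrix.mul_one, traceQ]

lemma evalMat_det {n : ℕ} (A : MatW n) : evalMat A (detPoly n : PolyW n) = A.det := by
  rw [evalMat, detPoly, Matrix.eval_det_mvPolynomialX]
  rfl

/-- The reflection along `y` fixes `A` and negates `det`, so the value here equals `(-1)^j` times
itself. -/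
lemma evalMat_hessTrace_det {n j : ℕ} (hj : Odd j) {y : Fin n → ℂ} (hy : y ⬝ᵥ y ≠ 0)
    {A : MatW n} (hA : Matrix.vecMul y A = 0) :
    evalMat A (hessTrace j (detPoly n : PolyW n)) = 0 := by
  have h1 : compLin (LinearMap.mulLeft ℂ (reflMat y)) (detPoly n : PolyW n) =
      MvPolynomial.C (-1) * (detPoly n : PolyW n) := by
    refine polyW_ext fun B => ?_
    rw [evalMat_compLin, evalMat_det, LinearMap.mulLeft_apply, Matrix.det_mul, det_reflMat hy]
    conv_rhs => rw [evalMat, map_mul, MvPolynomial.eval_C]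
    rw [← evalMat_det, evalMat]
  have h2 := hessTrace_compLin j (traceQ_reflMat_mul hy) (detPoly n : PolyW n)
  rw [h1, hessTrace_C_mul, hj.neg_one_pow] at h2
  have h3 := congrArg (evalMat A) h2
  rw [evalMat_compLin, LinearMap.mulLeft_apply, reflMat_mul hA] at h3
  simp only [evalMat, map_mul, MvPolynomial.eval_C] at h3 ⊢
  linear_combination (-1 / 2 : ℂ) * h3

lemma dvd_aeval_sub_aeval {σ R S : Type*} [CommRing R] [CommRing S] [Algebra R S] {d : S}
    {f g : σ → S} (h : ∀ i, d ∣ f i - g i) (P : MvPolynomial σ R) :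
    d ∣ MvPolynomial.aeval f P - MvPolynomial.aeval g P := by
  induction P using MvPolynomial.induction_on with
  | C r => simp
  | add P R hP hR =>
    rw [map_add, map_add, add_sub_add_comm]
    exact dvd_add hP hR
  | mul_X P i hP =>
    rw [map_mul, map_mul, MvPolynomial.aeval_X, MvPolynomial.aeval_X]
    exact dvd_mul_sub_mul hP (h i)

lemma aeval_mul_of_isHomogeneous {σ R S : Type*} [CommRing R] [CommRing S] [Algebra R S]
    {P : MvPolynomial σ R} {d : ℕ} (hP : P.IsHomogeneous d) (c : S) (f : σ → S) :
    MvPolynomial.aeval (fun i => c * f i) P = c ^ d * MvPolynomial.aeval f P := by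
  rw [MvPolynomial.aeval_def, MvPolynomial.aeval_def, MvPolynomial.eval₂_eq, MvPolynomial.eval₂_eq,
    Finset.mul_sum]
  refine Finset.sum_congr rfl fun s hs => ?_
  rw [hP.degree_eq_sum_deg_support hs]
  simp only [mul_pow, Finset.prod_mul_distrib, Finset.prod_pow_eq_pow_sum]
  rw [mul_left_comm]

/-- A row of the generic adjugate matrix. -/
noncomputable def adjRow (n : ℕ) (k : Fin n) : Fin n → PolyW n :=
  (Matrix.mvPolynomialX (Fin n) (Fin n) ℂ).adjugate k

lemma vecMul_adjRow (n : ℕ) (k : Fin n) :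
    Matrix.vecMul (adjRow n k) (Matrix.mvPolynomialX (Fin n) (Fin n) ℂ) =
      Pi.single k (detPoly n : PolyW n) := by
  ext1 i
  have h := congrFun (congrFun (Matrix.adjugate_mul (Matrix.mvPolynomialX (Fin n) (Fin n) ℂ)) k) i
  rw [Matrix.mul_apply'] at h
  rw [Matrix.vecMul, adjRow]
  refine h.trans ?_
  rw [Matrix.smul_apply, Matrix.one_apply, Pi.single_apply]
  simp [detPoly, eq_comm]

lemma dotProduct_adjRow_ne_zero (n : ℕ) (k : Fin n) : adjRow n k ⬝ᵥ adjRow n k ≠ 0 := by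
  intro h
  have h1 := congrArg (MvPolynomial.eval fun p : Fin n × Fin n => (1 : MatW n) p.1 p.2) h
  have h2 : ∀ i, MvPolynomial.eval (fun p : Fin n × Fin n => (1 : MatW n) p.1 p.2) (adjRow n k i) =
      (1 : MatW n) k i := by
    intro i
    have := congrFun (congrFun (RingHom.map_adjugate
      (MvPolynomial.eval fun p : Fin n × Fin n => (1 : MatW n) p.1 p.2)
      (Matrix.mvPolynomialX (Fin n) (Fin n) ℂ)) k) i
    rw [Matrix.mvPolynomialX_mapMatrix_eval, Matrix.adjugate_one] at this
    exact this
  simp only [dotProduct, map_sum, map_mul, h2, map_zero] at h1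
  simp [Matrix.one_apply] at h1

/-- Since `y * Y = det • e_k`, the generic matrix scaled by `q` is congruent modulo `det` to a
matrix `N` killed by `y`, at which the trace vanishes; homogeneity pulls the scaling out as a power
of `q`. -/
lemma detPoly_dvd_dotProduct_pow_mul {n j : ℕ} (hj : Odd j) (k : Fin n) :
    (detPoly n : PolyW n) ∣ (adjRow n k ⬝ᵥ adjRow n k) ^ (j * (n - 2)) *
      hessTrace j (detPoly n : PolyW n) := by
  set R := hessTrace j (detPoly n : PolyW n) with hR
  set y := adjRow n k with hy
  set q := y ⬝ᵥ y with hq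
  set Y := Matrix.mvPolynomialX (Fin n) (Fin n) ℂ with hY
  have hhom : R.IsHomogeneous (j * (n - 2)) := hessTrace_isHomogeneous j n (detPoly n).2
  -- `q` times the projection of the columns of `Y` to the hyperplane perpendicular to `y`, with
  -- denominators cleared.
  let N : Matrix (Fin n) (Fin n) (PolyW n) := q • Y - Matrix.vecMulVec y (Matrix.vecMul y Y)
  have hN : Matrix.vecMul y N = 0 := by
    simp only [N]
    rw [Matrix.vecMul_sub, Matrix.vecMul_smul, Matrix.vecMul_vecMulVec]
    simp [hq]
  have hzero : MvPolynomial.aeval (fun p : Fin n × Fin n => N p.1 p.2) R = 0 := by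
    -- The reflection argument needs `q ≠ 0` at the point; the extra factor `q` makes the identity
    -- hold at every point and is then cancelled.
    refine (mul_eq_zero.1 (?_ : q * _ = 0)).resolve_left (dotProduct_adjRow_ne_zero n k)
    refine polyW_ext fun A => ?_
    have hdot : evalMat A q = (fun i => evalMat A (y i)) ⬝ᵥ (fun i => evalMat A (y i)) := by
      simp [hq, evalMat, dotProduct]
    have hcomp : evalMat A (MvPolynomial.aeval (fun p : Fin n × Fin n => N p.1 p.2) R) =
        evalMat (N.map (evalMat A)) R := by
      rw [evalMat, evalMat, MvPolynomial.map_aeval, MvPolynomial.eval]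
      congr 1
      congr 1
      ext a
      simp
    rw [evalMat, map_mul]
    change evalMat A q * evalMat A _ = evalMat A 0
    rw [hcomp, show evalMat A (0 : PolyW n) = 0 from map_zero _, mul_eq_zero,
      or_iff_not_imp_left, hdot]
    intro h
    refine evalMat_hessTrace_det hj h ?_
    ext1 i
    have := congrArg (evalMat A) (congrFun hN i)
    simpa [Matrix.vecMul, dotProduct, evalMat] using this
  have hscale : MvPolynomial.aeval (fun p : Fin n × Fin n => q * MvPolynomial.X p) R =
      q ^ (j * (n - 2)) * R := by
    rw [aeval_mul_of_isHomogeneous hhom, MvPolynomial.aeval_X_left_apply]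
  have hmod : (detPoly n : PolyW n) ∣
      MvPolynomial.aeval (fun p : Fin n × Fin n => q * MvPolynomial.X p) R -
        MvPolynomial.aeval (fun p : Fin n × Fin n => N p.1 p.2) R := by
    refine dvd_aeval_sub_aeval (fun p => ?_) R
    have h : q * MvPolynomial.X p - N p.1 p.2 = y p.1 * Matrix.vecMul y Y p.2 := by
      simp [N, hY, Matrix.vecMulVec_apply]
    rw [h, hY, hy, vecMul_adjRow, Pi.single_apply]
    split_ifs
    · exact dvd_mul_left _ _
    · rw [mul_zero]
      exact dvd_zero _
  rw [hzero, sub_zero, hscale] at hmod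
  exact hmod

lemma vars_subset_of_dvd {σ R : Type*} [CommRing R] [IsDomain R] {p q : MvPolynomial σ R}
    (hq : q ≠ 0) (h : p ∣ q) : p.vars ⊆ q.vars := by
  classical
  obtain ⟨r, rfl⟩ := h
  have hp := left_ne_zero_of_mul hq
  have hr := right_ne_zero_of_mul hq
  intro i hi
  rw [MvPolynomial.mem_vars_iff_degreeOf_ne_zero] at hi ⊢
  rw [MvPolynomial.degreeOf_mul_eq hp hr]
  exact fun h => hi (Nat.eq_zero_of_add_eq_zero_right h)

/-- The entries of row `k` of the adjugate are, up to sign, minors that omit column `k`. -/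
lemma dotProduct_adjRow_mem_supported (n : ℕ) (k : Fin n) :
    adjRow n k ⬝ᵥ adjRow n k ∈ MvPolynomial.supported ℂ {p : Fin n × Fin n | p.2 ≠ k} := by
  obtain _ | m := n
  · exact k.elim0
  have h : ∀ i, adjRow (m + 1) k i ∈
      MvPolynomial.supported ℂ {p : Fin (m + 1) × Fin (m + 1) | p.2 ≠ k} := by
    intro i
    rw [adjRow, Matrix.adjugate_fin_succ_eq_det_submatrix, Matrix.det_apply]
    refine Subalgebra.mul_mem _ (Subalgebra.pow_mem _ (neg_mem (one_mem _)) _)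
      (Subalgebra.sum_mem _ fun σ _ => ?_)
    rw [Units.smul_def]
    refine zsmul_mem (Subalgebra.prod_mem _ fun a _ => ?_) _
    rw [Matrix.submatrix_apply, Matrix.mvPolynomialX_apply, MvPolynomial.X_mem_supported]
    exact Fin.succAbove_ne k a
  exact Subalgebra.sum_mem _ fun i _ => Subalgebra.mul_mem _ (h i) (h i)

/-- The gcd of the products `q k * b` is the gcd of the `q k`, a unit, times `b`, up to a unit. -/
lemma dvd_of_forall_dvd_mul {R ι : Type*} [CommRing R] [IsDomain R] [UniqueFactorizationMonoid R]
    [Finite ι] {a b : R} (q : ι → R) (h : ∀ k, a ∣ q k * b)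
    (hq : ∀ d, (∀ k, d ∣ q k) → IsUnit d) : a ∣ b := by
  classical
  have := Fintype.ofFinite ι
  let : StrongNormalizationMonoid R := UniqueFactorizationMonoid.strongNormalizationMonoid
  let : StrongNormalizedGCDMonoid R :=
    UniqueFactorizationMonoid.toStrongNormalizedGCDMonoid R
  have h1 : a ∣ Finset.univ.gcd fun k => q k * b := Finset.dvd_gcd fun k _ => h k
  have h2 : IsUnit (Finset.univ.gcd q) := hq _ fun k => Finset.gcd_dvd (Finset.mem_univ k)
  rwa [Finset.gcd_mul_right, h2.dvd_mul_left, dvd_normalize_iff] at h1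

lemma detPoly_dvd_hessTrace {n j : ℕ} (hn : n ≠ 0) (hj : Odd j) :
    (detPoly n : PolyW n) ∣ hessTrace j (detPoly n : PolyW n) := by
  refine dvd_of_forall_dvd_mul _ (detPoly_dvd_dotProduct_pow_mul hj) fun d hd => ?_
  have hne : ∀ k, (adjRow n k ⬝ᵥ adjRow n k) ^ (j * (n - 2)) ≠ 0 := fun k =>
    pow_ne_zero _ (dotProduct_adjRow_ne_zero n k)
  -- A variable of `d` in column `k` would also occur in the power of `q_k`.
  have hvars : d.vars = ∅ := by
    refine Finset.eq_empty_of_forall_notMem fun p hp => ?_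
    have h := MvPolynomial.mem_supported.1
      (Subalgebra.pow_mem _ (dotProduct_adjRow_mem_supported n p.2) (j * (n - 2)))
      (vars_subset_of_dvd (hne p.2) (hd p.2) hp)
    exact h rfl
  have : d ≠ 0 := ne_zero_of_dvd_ne_zero (hne ⟨0, Nat.pos_of_ne_zero hn⟩) (hd _)
  rw [MvPolynomial.vars_eq_empty_iff_eq_C.1 hvars] at this ⊢
  exact (isUnit_iff_ne_zero.2 fun h => this (by rw [h, map_zero])).map MvPolynomial.C

/-! ### Pseudo-division -/

/-- The pseudo-remainder of `r` by `p`, regarded as a polynomial of degree `n`, after `m` steps that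
remove in turn the coefficients of degree `n + m - 1, …, n` of `r`. -/
noncomputable def psRem {S : Type*} [CommRing S] (p : Polynomial S) (n : ℕ) :
    ℕ → Polynomial S → Polynomial S
  | 0, r => r
  | m + 1, r => psRem p n m (Polynomial.C (p.coeff n) * r -
      Polynomial.C (r.coeff (n + m)) * Polynomial.X ^ m * p)

lemma psRem_map {S T : Type*} [CommRing S] [CommRing T] (φ : S →+* T) (p : Polynomial S)
    (n m : ℕ) (r : Polynomial S) :
    (psRem p n m r).map φ = psRem (p.map φ) n m (r.map φ) := by
  induction m generalizing r with
  | zero => rfl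
  | succ m ih => simp [psRem, ih]

lemma psRem_zero_right {S : Type*} [CommRing S] (p : Polynomial S) (n m : ℕ) :
    psRem p n m 0 = 0 := by
  induction m with
  | zero => rfl
  | succ m ih => simp [psRem, ih]

lemma exists_psRem {S : Type*} [CommRing S] (p : Polynomial S) (n m : ℕ) (r : Polynomial S) :
    ∃ q, Polynomial.C (p.coeff n ^ m) * r = q * p + psRem p n m r := by
  induction m generalizing r with
  | zero => exact ⟨0, by simp [psRem]⟩
  | succ m ih =>
    obtain ⟨q, hq⟩ := ih (Polynomial.C (p.coeff n) * r -
      Polynomial.C (r.coeff (n + m)) * Polynomial.X ^ m * p)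
    refine ⟨q + Polynomial.C (p.coeff n ^ m) * Polynomial.C (r.coeff (n + m)) * Polynomial.X ^ m,
      ?_⟩
    rw [psRem]
    simp only [map_pow] at hq ⊢
    linear_combination hq

lemma degree_psRem_lt {S : Type*} [CommRing S] {p : Polynomial S} {n : ℕ} (hp : p.natDegree ≤ n)
    (m : ℕ) {r : Polynomial S} (hr : r.degree < (n + m : ℕ)) : (psRem p n m r).degree < n := by
  induction m generalizing r with
  | zero => exact hr
  | succ m ih =>
    refine ih ((Polynomial.degree_lt_iff_coeff_zero _ _).2 fun i hi => ?_)
    rw [Polynomial.coeff_sub, Polynomial.coeff_C_mul, mul_assoc, Polynomial.coeff_C_mul,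
      Polynomial.coeff_X_pow_mul', if_pos (by omega)]
    rcases hi.eq_or_lt with rfl | hi
    · rw [Nat.add_sub_cancel, mul_comm, sub_self]
    · rw [(Polynomial.degree_lt_iff_coeff_zero _ _).1 hr i (by omega),
        Polynomial.coeff_eq_zero_of_natDegree_lt (p := p) (n := i - m) (by omega), mul_zero, mul_zero,
        sub_zero]

lemma psRem_of_degree_lt {S : Type*} [CommRing S] (p : Polynomial S) {n : ℕ} (m : ℕ)
    {r : Polynomial S} (hr : r.degree < n) :
    psRem p n m r = Polynomial.C (p.coeff n ^ m) * r := by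
  induction m generalizing r with
  | zero => simp [psRem]
  | succ m ih =>
    have h : r.coeff (n + m) = 0 := (Polynomial.degree_lt_iff_coeff_zero _ _).1 hr _ (by omega)
    rw [psRem, h, map_zero, zero_mul, zero_mul, sub_zero, ih, ← mul_assoc, ← map_mul, pow_succ]
    refine (Polynomial.degree_lt_iff_coeff_zero _ _).2 fun i hi => ?_
    rw [Polynomial.coeff_C_mul, (Polynomial.degree_lt_iff_coeff_zero _ _).1 hr i hi, mul_zero]

lemma psRem_eq_zero_of_dvd {K : Type*} [Field K] {p r : Polynomial K} {n : ℕ}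
    (hp : p.natDegree ≤ n) (m : ℕ) (hr : r.natDegree ≤ n + m) (hdvd : p ∣ r)
    (h0 : p.coeff n = 0 → r.coeff (n + m) = 0) : psRem p n (m + 1) r = 0 := by
  by_cases hpn : p.coeff n = 0
  -- With both top coefficients zero, the first step already gives `0`; this covers a drop in the
  -- degree of `p`.
  · rw [psRem, h0 hpn, hpn]
    simp [psRem_zero_right]
  · have hdeg : (psRem p n (m + 1) r).degree < n := degree_psRem_lt hp _
      (lt_of_le_of_lt (Polynomial.degree_le_of_natDegree_le hr) (by norm_cast; omega))
    obtain ⟨q, hq⟩ := exists_psRem p n (m + 1) r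
    refine Polynomial.eq_zero_of_dvd_of_degree_lt (p := p) ?_
      (hdeg.trans_le (Polynomial.le_degree_of_ne_zero hpn))
    exact (dvd_add_right (dvd_mul_left p q)).1 (hq ▸ hdvd.mul_left _)

/-! ### Families of polynomials whose coefficients are forms -/

lemma one_mem_polyForms_zero (V : Type*) [AddCommGroup V] [Module ℂ V] :
    (1 : V → ℂ) ∈ polyForms V 0 := by
  rw [polyForms, pow_zero]
  exact Submodule.one_le.1 le_rfl

lemma mul_mem_polyForms {V : Type*} [AddCommGroup V] [Module ℂ V] {k l : ℕ} {F G : V → ℂ}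
    (hF : F ∈ polyForms V k) (hG : G ∈ polyForms V l) : F * G ∈ polyForms V (k + l) := by
  rw [polyForms, pow_add]
  exact Submodule.mul_mem_mul hF hG

lemma linearMap_mem_polyForms {V : Type*} [AddCommGroup V] [Module ℂ V] (f : V →ₗ[ℂ] ℂ) :
    (fun v => f v) ∈ polyForms V 1 := by
  rw [polyForms, pow_one]
  exact ⟨f, rfl⟩

/-- All the coefficients of the family `f` of polynomials are forms of degree `k`. -/
def HasFormCoeffs {V : Type*} [AddCommGroup V] [Module ℂ V] (k : ℕ) (f : V → Polynomial ℂ) :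
    Prop :=
  ∀ i, (fun v => (f v).coeff i) ∈ polyForms V k

namespace HasFormCoeffs

variable {V : Type*} [AddCommGroup V] [Module ℂ V] {k l : ℕ} {f g : V → Polynomial ℂ}

lemma const (p : Polynomial ℂ) : HasFormCoeffs 0 fun _ : V => p := fun i => by
  have := Submodule.smul_mem _ (p.coeff i) (one_mem_polyForms_zero V)
  convert this using 1
  ext v
  simp

lemma sub (hf : HasFormCoeffs k f) (hg : HasFormCoeffs k g) :
    HasFormCoeffs k fun v => f v - g v := fun i => by
  simp only [Polynomial.coeff_sub]
  exact Submodule.sub_mem _ (hf i) (hg i)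

lemma sum {ι : Type*} (s : Finset ι) {f : ι → V → Polynomial ℂ}
    (hf : ∀ a ∈ s, HasFormCoeffs k (f a)) : HasFormCoeffs k fun v => ∑ a ∈ s, f a v := fun i => by
  have := Submodule.sum_mem _ fun a ha => hf a ha i
  convert this using 1
  ext v
  simp [Finset.sum_apply]

lemma mul (hf : HasFormCoeffs k f) (hg : HasFormCoeffs l g) :
    HasFormCoeffs (k + l) fun v => f v * g v := fun i => by
  have := Submodule.sum_mem (t := Finset.HasAntidiagonal.antidiagonal i) _
    fun a _ => mul_mem_polyForms (hf a.1) (hg a.2)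
  convert this using 1
  ext v
  simp [Polynomial.coeff_mul, Finset.sum_apply]

lemma prod {ι : Type*} (s : Finset ι) {f : ι → V → Polynomial ℂ}
    (hf : ∀ a ∈ s, HasFormCoeffs 1 (f a)) : HasFormCoeffs s.card fun v => ∏ a ∈ s, f a v := by
  classical
  induction s using Finset.induction_on with
  | empty => simpa using const (V := V) 1
  | insert a s ha ih =>
    simp only [Finset.prod_insert ha, Finset.card_insert_of_notMem ha]
    rw [add_comm]
    exact (hf a (Finset.mem_insert_self a s)).mul
      (ih fun b hb => hf b (Finset.mem_insert_of_mem hb))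

lemma of_linearMap (f : V →ₗ[ℂ] Polynomial ℂ) : HasFormCoeffs 1 fun v => f v := fun i =>
  linearMap_mem_polyForms (Polynomial.lcoeff ℂ i ∘ₗ f)

lemma C_coeff (hf : HasFormCoeffs k f) (i : ℕ) :
    HasFormCoeffs k fun v => Polynomial.C ((f v).coeff i) := fun l => by
  simp only [Polynomial.coeff_C]
  split_ifs
  · exact hf i
  · exact Submodule.zero_mem _

/-- Each step multiplies by `f`, or a coefficient of it, exactly once, so it raises the degree by
one. -/
lemma psRem (hf : HasFormCoeffs 1 f) (hg : HasFormCoeffs k g) (n m : ℕ) :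
    HasFormCoeffs (k + m) fun v => psRem (f v) n m (g v) := by
  induction m generalizing g k with
  | zero => exact hg
  | succ m ih =>
    rw [show k + (m + 1) = k + 1 + m by ring]
    refine ih (HasFormCoeffs.sub ?_ ?_)
    · rw [Nat.add_comm]
      exact (hf.C_coeff n).mul hg
    · exact ((hg.C_coeff (n + m)).mul (const (Polynomial.X ^ m))).mul hf

end HasFormCoeffs

/-! ### Restriction to lines -/

/-- The restriction of a polynomial to the line `t ↦ t v + w`. -/
noncomputable def lineRes {σ S : Type*} [CommRing S] [Algebra ℂ S] (v w : σ → S) :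
    MvPolynomial σ ℂ →ₐ[ℂ] Polynomial S :=
  MvPolynomial.aeval fun a => Polynomial.C (v a) * Polynomial.X + Polynomial.C (w a)

lemma lineRes_X {σ S : Type*} [CommRing S] [Algebra ℂ S] (v w : σ → S) (a : σ) :
    lineRes v w (MvPolynomial.X a) =
      Polynomial.C (v a) * Polynomial.X + Polynomial.C (w a) :=
  MvPolynomial.aeval_X _ a

lemma natDegree_lineRes_X_le {S : Type*} [CommRing S] (a b : S) :
    (Polynomial.C a * Polynomial.X + Polynomial.C b).natDegree ≤ 1 :=
  Polynomial.natDegree_linear_le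

lemma natDegree_prod_pow_le {σ S : Type*} [CommRing S] {f : σ → Polynomial S}
    (hf : ∀ i, (f i).natDegree ≤ 1) (d : σ → ℕ) (s : Finset σ) :
    (∏ i ∈ s, f i ^ d i).natDegree ≤ ∑ i ∈ s, d i :=
  (Polynomial.natDegree_prod_le _ _).trans (Finset.sum_le_sum fun i _ => by
    simpa using Polynomial.natDegree_pow_le_of_le (d i) (hf i))

lemma coeff_prod_pow {σ S : Type*} [CommRing S] {f : σ → Polynomial S}
    (hf : ∀ i, (f i).natDegree ≤ 1) (d : σ → ℕ) (s : Finset σ) :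
    (∏ i ∈ s, f i ^ d i).coeff (∑ i ∈ s, d i) = ∏ i ∈ s, (f i).coeff 1 ^ d i := by
  classical
  induction s using Finset.induction_on with
  | empty => simp
  | insert a s ha ih =>
    rw [Finset.prod_insert ha, Finset.sum_insert ha, Finset.prod_insert ha,
      Polynomial.coeff_mul_add_eq_of_natDegree_le _ (natDegree_prod_pow_le hf d s), ih]
    · congr 1
      simpa using Polynomial.coeff_pow_of_natDegree_le (m := d a) (hf a)
    · simpa using Polynomial.natDegree_pow_le_of_le (d a) (hf a)

lemma natDegree_lineRes_le {σ S : Type*} [CommRing S] [Algebra ℂ S] (v w : σ → S)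
    {P : MvPolynomial σ ℂ} {d : ℕ} (hP : P.IsHomogeneous d) : (lineRes v w P).natDegree ≤ d := by
  rw [lineRes, MvPolynomial.aeval_def, MvPolynomial.eval₂_eq]
  refine Polynomial.natDegree_sum_le_of_forall_le _ _ fun s hs => ?_
  rw [hP.degree_eq_sum_deg_support hs, Polynomial.algebraMap_apply]
  exact (Polynomial.natDegree_C_mul_le _ _).trans
    (natDegree_prod_pow_le (fun i => natDegree_lineRes_X_le _ _) s s.support)

lemma coeff_lineRes {σ S : Type*} [CommRing S] [Algebra ℂ S] (v w : σ → S)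
    {P : MvPolynomial σ ℂ} {d : ℕ} (hP : P.IsHomogeneous d) :
    (lineRes v w P).coeff d = MvPolynomial.aeval v P := by
  rw [lineRes, MvPolynomial.aeval_def, MvPolynomial.eval₂_eq, MvPolynomial.aeval_def,
    MvPolynomial.eval₂_eq, Polynomial.finsetSum_coeff]
  refine Finset.sum_congr rfl fun s hs => ?_
  rw [Polynomial.algebraMap_apply, Polynomial.coeff_C_mul, hP.degree_eq_sum_deg_support hs]
  congr 1
  have := coeff_prod_pow (fun i => natDegree_lineRes_X_le (v i) (w i)) s s.support
  simpa using this

lemma eval_zero_lineRes {σ S : Type*} [CommRing S] [Algebra ℂ S] (v w : σ → S)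
    (P : MvPolynomial σ ℂ) : (lineRes v w P).eval 0 = MvPolynomial.aeval w P := by
  induction P using MvPolynomial.induction_on with
  | C r => simp [lineRes, Polynomial.algebraMap_apply]
  | add P R hP hR => simp [hP, hR]
  | mul_X P i hP => simp [hP, lineRes_X]

lemma map_lineRes {σ S T : Type*} [CommRing S] [CommRing T] [Algebra ℂ S] [Algebra ℂ T]
    (φ : S →ₐ[ℂ] T) (v w : σ → S) (P : MvPolynomial σ ℂ) :
    (lineRes v w P).map (φ : S →+* T) = lineRes (fun i => φ (v i)) (fun i => φ (w i)) P := by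
  induction P using MvPolynomial.induction_on with
  | C r => simp [lineRes, Polynomial.algebraMap_apply]
  | add P R hP hR => simp [hP, hR]
  | mul_X P i hP => simp [hP, lineRes_X]

/-! ### The equations -/

/-- The coefficients of the pseudo-remainder of `trace (H(P)^{∧ j})` by `P` on a line. -/
noncomputable def remForm (n j : ℕ) (v w : Fin n × Fin n → ℂ) (i : ℕ) (P : SymW n) : ℂ :=
  (psRem (lineRes v w (P : PolyW n)) n (j * (n - 2) + 1 - n)
    (lineRes v w (hessTrace j (P : PolyW n)))).coeff i

lemma hasFormCoeffs_lineRes {n : ℕ} (v w : Fin n × Fin n → ℂ) :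
    HasFormCoeffs 1 fun P : SymW n => lineRes v w (P : PolyW n) :=
  HasFormCoeffs.of_linearMap ((lineRes v w).toLinearMap ∘ₗ (SymW n).subtype)

lemma hasFormCoeffs_lineRes_hessTrace {n : ℕ} (j : ℕ) (v w : Fin n × Fin n → ℂ) :
    HasFormCoeffs j fun P : SymW n => lineRes v w (hessTrace j (P : PolyW n)) := by
  simp only [hessTrace_eq_sum_minors, map_sum]
  refine HasFormCoeffs.sum _ fun s hs => ?_
  simp only [Matrix.det_apply, map_sum]
  refine HasFormCoeffs.sum _ fun σ _ => ?_
  have h := HasFormCoeffs.prod (V := SymW n) (Finset.univ : Finset s)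
    (f := fun i P => lineRes v w (hessMat (P : PolyW n) (σ i) i))
    fun i _ => HasFormCoeffs.of_linearMap ((lineRes v w).toLinearMap ∘ₗ
      (MvPolynomial.pderiv ((σ i : s) : Fin n × Fin n)).toLinearMap ∘ₗ
      (MvPolynomial.pderiv (i : Fin n × Fin n)).toLinearMap ∘ₗ (SymW n).subtype)
  rw [Finset.card_univ, Fintype.card_coe, (Finset.mem_powersetCard.1 hs).2] at h
  have h' := (HasFormCoeffs.const (V := SymW n) ((Equiv.Perm.sign σ : ℤ) : Polynomial ℂ)).mul h
  rw [zero_add] at h'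
  convert h' using 2 with P
  rw [Units.smul_def, zsmul_eq_mul, map_mul, map_intCast, map_prod]
  rfl

lemma remForm_mem_polyForms (n j : ℕ) (v w : Fin n × Fin n → ℂ) (i : ℕ) :
    remForm n j v w i ∈ polyForms (SymW n) (j + (j * (n - 2) + 1 - n)) :=
  (hasFormCoeffs_lineRes v w).psRem (hasFormCoeffs_lineRes_hessTrace j v w) n _ i

lemma eq_zero_of_dvd_of_isHomogeneous {σ R : Type*} [CommRing R] [IsDomain R]
    {P Q : MvPolynomial σ R} {d e : ℕ} (hP : P.IsHomogeneous d) (hQ : Q.IsHomogeneous e)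
    (hed : e < d) (h : P ∣ Q) : Q = 0 := by
  by_contra hQ0
  obtain ⟨S, rfl⟩ := h
  have h1 := hQ.totalDegree hQ0
  rw [MvPolynomial.totalDegree_mul_of_isDomain (left_ne_zero_of_mul hQ0)
    (right_ne_zero_of_mul hQ0), hP.totalDegree (left_ne_zero_of_mul hQ0)] at h1
  omega

lemma remForm_eq_zero_of_dvd {n j : ℕ} {P : SymW n}
    (h : (P : PolyW n) ∣ hessTrace j (P : PolyW n)) (v w : Fin n × Fin n → ℂ) (i : ℕ) :
    remForm n j v w i P = 0 := by
  have hR := hessTrace_isHomogeneous j n P.2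
  have hdvd : lineRes v w (P : PolyW n) ∣ lineRes v w (hessTrace j (P : PolyW n)) :=
    map_dvd (lineRes v w) h
  rw [remForm]
  -- In low degree the number of steps may truncate to zero, but then divisibility forces the trace
  -- itself to vanish.
  rcases lt_or_ge (j * (n - 2)) n with hlt | hge
  · rw [eq_zero_of_dvd_of_isHomogeneous P.2 hR hlt h, map_zero, psRem_zero_right,
      Polynomial.coeff_zero]
  · obtain ⟨m, hm⟩ := Nat.exists_eq_add_of_le hge
    rw [show j * (n - 2) + 1 - n = m + 1 by omega, psRem_eq_zero_of_dvd
      (natDegree_lineRes_le v w P.2) m (hm ▸ natDegree_lineRes_le v w hR) hdvd,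
      Polynomial.coeff_zero]
    intro h0
    -- The top coefficients on the line are the values at `v`, and a zero of `P` is a zero of any
    -- multiple of `P`.
    rw [coeff_lineRes v w P.2] at h0
    rw [← hm, coeff_lineRes v w hR, ← zero_dvd_iff, ← h0]
    exact map_dvd (MvPolynomial.aeval v) h

/-- On the line through the generic point `X` in a direction `v` with `P(v) ≠ 0`, the top
coefficient of `P` is a unit, so the pseudo-division is a true division; setting `t = 0` gives back
the polynomials themselves. -/
lemma dvd_hessTrace_of_remForm_eq_zero {n j : ℕ} {P : SymW n} (hP : P ≠ 0)
    (h : ∀ v w i, remForm n j v w i P = 0) : (P : PolyW n) ∣ hessTrace j (P : PolyW n) := by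
  obtain ⟨v, hv⟩ : ∃ v, MvPolynomial.eval v (P : PolyW n) ≠ 0 := by
    by_contra! hv
    exact hP (Subtype.ext (MvPolynomial.funext fun x => by rw [hv x]; exact (map_zero _).symm))
  set m := j * (n - 2) + 1 - n with hm
  set v' : Fin n × Fin n → PolyW n := fun a => MvPolynomial.C (v a) with hv'
  have hlead : (lineRes v' MvPolynomial.X (P : PolyW n)).coeff n =
      MvPolynomial.C (MvPolynomial.eval v (P : PolyW n)) := by
    rw [coeff_lineRes _ _ P.2, MvPolynomial.aeval_def]
    exact (MvPolynomial.eval₂_comp_left MvPolynomial.C (RingHom.id ℂ) v (P : PolyW n)).symm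
  have hzero : psRem (lineRes v' MvPolynomial.X (P : PolyW n)) n m
      (lineRes v' MvPolynomial.X (hessTrace j (P : PolyW n))) = 0 := by
    -- A coefficient over the polynomial ring is zero once it is zero after every specialisation `X
    -- ↦ w`.
    refine Polynomial.ext fun i => MvPolynomial.funext fun w => ?_
    have hmap : ∀ R : PolyW n, (lineRes v' MvPolynomial.X R).map
        (MvPolynomial.eval w) = lineRes v w R := by
      intro R
      have := map_lineRes (MvPolynomial.aeval w : PolyW n →ₐ[ℂ] ℂ) v' MvPolynomial.X R
      simpa [hv'] using this
    rw [← Polynomial.coeff_map, psRem_map, hmap, hmap, Polynomial.coeff_zero, map_zero]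
    exact h v w i
  obtain ⟨q, hq⟩ := exists_psRem (lineRes v' MvPolynomial.X (P : PolyW n)) n m
    (lineRes v' MvPolynomial.X (hessTrace j (P : PolyW n)))
  have h1 := congrArg (Polynomial.eval 0) hq
  rw [hzero, add_zero, hlead, Polynomial.eval_mul, Polynomial.eval_mul, eval_zero_lineRes,
    eval_zero_lineRes, Polynomial.eval_C, MvPolynomial.aeval_X_left_apply,
    MvPolynomial.aeval_X_left_apply] at h1
  have hunit : IsUnit ((MvPolynomial.C (MvPolynomial.eval v (P : PolyW n)) : PolyW n) ^ m) :=
    ((isUnit_iff_ne_zero.2 hv).map MvPolynomial.C).pow m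
  exact (hunit.dvd_mul_left).1 ⟨_, h1.trans (mul_comm _ _)⟩

/-! ### The orbit closure -/

lemma traceQ_symm {n : ℕ} (g : orthW n) (A : MatW n) :
    traceQ n (((g⁻¹ : orthW n) : MatW n ≃ₗ[ℂ] MatW n).toLinearMap A) = traceQ n A :=
  (g⁻¹ : orthW n).2 A

lemma hessTrace_symRep {n : ℕ} (j : ℕ) (g : orthW n) (P : SymW n) :
    hessTrace j (symRep n g P : PolyW n) =
      compLin ((g⁻¹ : orthW n) : MatW n ≃ₗ[ℂ] MatW n).toLinearMap (hessTrace j (P : PolyW n)) :=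
  hessTrace_compLin j (traceQ_symm g) (P : PolyW n)

lemma symRep_dvd_hessTrace {n j : ℕ} (g : orthW n) {P : SymW n}
    (h : (P : PolyW n) ∣ hessTrace j (P : PolyW n)) :
    (symRep n g P : PolyW n) ∣ hessTrace j (symRep n g P : PolyW n) := by
  rw [hessTrace_symRep]
  exact map_dvd (compLin ((g⁻¹ : orthW n) : MatW n ≃ₗ[ℂ] MatW n).toLinearMap) h

lemma dvd_hessTrace_of_mem_detOrbitClosure {n j : ℕ} (hn : n ≠ 0) (hj : Odd j) {P : SymW n}
    (hP : P ≠ 0) (hmem : Projectivization.mk ℂ P hP ∈ detOrbitClosure n) :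
    (P : PolyW n) ∣ hessTrace j (P : PolyW n) := by
  refine dvd_hessTrace_of_remForm_eq_zero hP fun v w i => ?_
  refine hmem _ _ (remForm_mem_polyForms n j v w i) (fun R hR hRmem => ?_) P hP rfl
  obtain ⟨g, hg⟩ := hRmem
  obtain ⟨c, hc⟩ := (Projectivization.mk_eq_mk_iff ℂ _ _ _ _).1 hg
  refine remForm_eq_zero_of_dvd ?_ v w i
  have h1 := symRep_dvd_hessTrace g (detPoly_dvd_hessTrace hn hj)
  have h2 : (symRep n g (detPoly n) : PolyW n) = MvPolynomial.C (c : ℂ) * (R : PolyW n) := by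
    rw [← hc, ← MvPolynomial.smul_eq_C_mul]
    rfl
  have hu : IsUnit (MvPolynomial.C (c : ℂ) : PolyW n) := c.isUnit.map MvPolynomial.C
  rwa [h2, hessTrace_C_mul, map_pow, hu.mul_left_dvd, (hu.pow j).dvd_mul_left] at h1

/-! ### A polynomial that does not divide the trace -/

/-- The sum of the `n`-th powers of the variables in `T`. -/
noncomputable def fermat (n : ℕ) (T : Finset (Fin n × Fin n)) : SymW n :=
  ⟨∑ a ∈ T, MvPolynomial.X a ^ n, Submodule.sum_mem _ fun a _ =>
    (MvPolynomial.mem_homogeneousSubmodule n _).2 (MvPolynomial.isHomogeneous_X_pow a n)⟩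

lemma pderiv_sum_X_pow {σ : Type*} [DecidableEq σ] (T : Finset σ) (n : ℕ) (a : σ) :
    MvPolynomial.pderiv a (∑ b ∈ T, MvPolynomial.X b ^ n : MvPolynomial σ ℂ) =
      if a ∈ T then (n : MvPolynomial σ ℂ) * MvPolynomial.X a ^ (n - 1) else 0 := by
  rw [map_sum]
  simp only [MvPolynomial.pderiv_pow, MvPolynomial.pderiv_X, Pi.single_apply]
  simp

lemma hessMat_fermat (n : ℕ) (T : Finset (Fin n × Fin n)) :
    hessMat (fermat n T : PolyW n) = Matrix.diagonal fun a =>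
      if a ∈ T then (n * (n - 1 : ℕ) : PolyW n) * MvPolynomial.X a ^ (n - 2) else 0 := by
  ext1 a b
  rw [hessMat_apply, fermat, pderiv_sum_X_pow, Matrix.diagonal_apply]
  by_cases hb : b ∈ T
  · rw [if_pos hb]
    by_cases hab : a = b
    · subst hab
      rw [if_pos rfl, if_pos hb, ← nsmul_eq_mul, map_nsmul, MvPolynomial.pderiv_pow,
        MvPolynomial.pderiv_X_self, nsmul_eq_mul, mul_one, mul_assoc, Nat.sub_sub]
    · rw [if_neg hab, ← nsmul_eq_mul, map_nsmul, MvPolynomial.pderiv_pow,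
        MvPolynomial.pderiv_X_of_ne (Ne.symm hab), mul_zero, smul_zero]
  · rw [if_neg hb, map_zero]
    split_ifs with hab ha
    · exact absurd (hab ▸ ha) hb
    · rfl
    · rfl

/-- The Hessian is diagonal and supported on `T`, so only the minor on `T` itself survives. -/
lemma hessTrace_fermat (n : ℕ) (T : Finset (Fin n × Fin n)) :
    hessTrace T.card (fermat n T : PolyW n) =
      ∏ a ∈ T, (n * (n - 1 : ℕ) : PolyW n) * MvPolynomial.X a ^ (n - 2) := by
  rw [hessTrace_eq_sum_minors, hessMat_fermat, Finset.sum_eq_single T]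
  · rw [Matrix.submatrix_diagonal _ _ Subtype.val_injective, Matrix.det_diagonal]
    rw [← Finset.prod_coe_sort T]
    exact Finset.prod_congr rfl fun a _ => if_pos (Subtype.prop a)
  · intro s hs hsT
    rw [Matrix.submatrix_diagonal _ _ Subtype.val_injective, Matrix.det_diagonal]
    obtain ⟨a, has, haT⟩ : ∃ a ∈ s, a ∉ T := by
      by_contra! hsub
      exact hsT (Finset.eq_of_subset_of_card_le hsub (Finset.mem_powersetCard.1 hs).2.ge)
    exact Finset.prod_eq_zero (Finset.mem_univ (⟨a, has⟩ : s)) (if_neg haT)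
  · intro h
    exact absurd (Finset.mem_powersetCard.2 ⟨Finset.subset_univ _, rfl⟩) h

lemma exists_remForm_ne_zero {n j : ℕ} (hn : 2 ≤ n) (hj : 0 < j) (hjn : j ≤ n ^ 2) :
    ∃ v w i P, remForm n j v w i P ≠ 0 := by
  obtain ⟨T, hT⟩ : ∃ T : Finset (Fin n × Fin n), T.card = j := by
    obtain ⟨T, -, hT⟩ := Finset.exists_subset_card_eq
      (s := (Finset.univ : Finset (Fin n × Fin n))) (n := j) (by simpa [sq] using hjn)
    exact ⟨T, hT⟩
  subst hT
  obtain ⟨a, ha⟩ := Finset.card_pos.1 hj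
  -- On this line the variable `a` is `t` and all others are `1`, so the trace becomes a nonzero
  -- multiple of `t^(n-2)`, already of degree below `n`, and the top coefficient of the Fermat sum
  -- is `1`.
  let v : Fin n × Fin n → ℂ := fun b => if b = a then 1 else 0
  let w : Fin n × Fin n → ℂ := fun b => if b = a then 0 else 1
  have hXa : lineRes v w (MvPolynomial.X a) = Polynomial.X := by simp [lineRes_X, v, w]
  have hXb : ∀ b, b ≠ a → lineRes v w (MvPolynomial.X b) = 1 := fun b hb => by
    simp [lineRes_X, v, w, hb]
  have hlead : (lineRes v w (fermat n T : PolyW n)).coeff n = 1 := by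
    rw [coeff_lineRes v w (fermat n T).2, fermat, map_sum, Finset.sum_eq_single a]
    · simp [v]
    · intro b _ hb
      simp [v, hb, show n ≠ 0 by omega]
    · exact fun h => absurd ha h
  have hR : lineRes v w (hessTrace T.card (fermat n T : PolyW n)) =
      Polynomial.C (((n * (n - 1 : ℕ) : ℂ)) ^ T.card) * Polynomial.X ^ (n - 2) := by
    rw [hessTrace_fermat, map_prod, Finset.prod_congr rfl fun b _ => map_mul _ _ _,
      Finset.prod_mul_distrib, Finset.prod_const, ← Finset.mul_prod_erase _ _ ha]
    rw [Finset.prod_eq_one fun b hb => by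
      rw [map_pow, hXb b (Finset.ne_of_mem_erase hb), one_pow]]
    simp [hXa]
  have hc : ((n * (n - 1 : ℕ) : ℂ)) ^ T.card ≠ 0 := by
    refine pow_ne_zero _ (mul_ne_zero ?_ ?_) <;> exact Nat.cast_ne_zero.2 (by omega)
  refine ⟨v, w, n - 2, fermat n T, ?_⟩
  rw [remForm, hR, psRem_of_degree_lt, hlead, one_pow, map_one, one_mul,
    Polynomial.coeff_C_mul_X_pow, if_pos rfl]
  · exact hc
  · rw [Polynomial.degree_C_mul_X_pow _ hc]
    norm_cast
    omega

/-! ### The module of equations -/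

/-- The forms of degree `k` on `S^n W` that vanish wherever `P` divides
`trace (H(P)^{∧ j})`. -/
noncomputable def hessEquations (n j k : ℕ) : Submodule ℂ (SymW n → ℂ) where
  carrier := {F | F ∈ polyForms (SymW n) k ∧
    ∀ P : SymW n, (P : PolyW n) ∣ hessTrace j (P : PolyW n) → F P = 0}
  add_mem' hF hG := ⟨Submodule.add_mem _ hF.1 hG.1, fun P hP => by
    rw [Pi.add_apply, hF.2 P hP, hG.2 P hP, add_zero]⟩
  zero_mem' := ⟨Submodule.zero_mem _, fun _ _ => rfl⟩
  smul_mem' c F hF := ⟨Submodule.smul_mem _ c hF.1, fun P hP => by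
    rw [Pi.smul_apply, hF.2 P hP, smul_zero]⟩

lemma comp_mem_polyForms {V : Type*} [AddCommGroup V] [Module ℂ V] {k : ℕ} (f : V →ₗ[ℂ] V)
    {F : V → ℂ} (hF : F ∈ polyForms V k) : (fun v => F (f v)) ∈ polyForms V k := by
  let φ : (V → ℂ) →ₐ[ℂ] (V → ℂ) := AlgHom.pi fun v => Pi.evalAlgHom ℂ _ (f v)
  have h1 : (linearForms V).map φ.toLinearMap ≤ linearForms V := by
    rintro _ ⟨_, ⟨l, rfl⟩, rfl⟩
    exact ⟨l ∘ₗ f, rfl⟩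
  have h2 : (polyForms V k).map φ.toLinearMap ≤ polyForms V k := by
    rw [polyForms, Submodule.map_pow]
    exact pow_le_pow_left' h1 k
  exact h2 ⟨F, hF, rfl⟩

lemma symRep_mem_hessEquations {n j k : ℕ} (g : orthW n) {F : SymW n → ℂ}
    (hF : F ∈ hessEquations n j k) : (fun P => F (symRep n g P)) ∈ hessEquations n j k :=
  ⟨comp_mem_polyForms (symRep n g) hF.1, fun _ hP => hF.2 _ (symRep_dvd_hessTrace g hP)⟩

lemma pow_mem_polyForms {V : Type*} [AddCommGroup V] [Module ℂ V] {k : ℕ} {F : V → ℂ}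
    (hF : F ∈ polyForms V k) (m : ℕ) : F ^ m ∈ polyForms V (k * m) := by
  rw [polyForms, pow_mul]
  exact Submodule.pow_mem_pow _ hF m

/-- The power `e` of a coefficient of the pseudo-remainder is a nonzero equation. -/
lemma hessEquations_ne_bot {n j k e : ℕ} (hn : 2 ≤ n) (hj : 0 < j) (hjn : j ≤ n ^ 2) (he : e ≠ 0)
    (hk : (j + (j * (n - 2) + 1 - n)) * e = k) : hessEquations n j k ≠ ⊥ := by
  obtain ⟨v, w, i, P, hP⟩ := exists_remForm_ne_zero hn hj hjn
  intro hbot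
  have hmem : remForm n j v w i ^ e ∈ hessEquations n j k :=
    ⟨hk ▸ pow_mem_polyForms (remForm_mem_polyForms n j v w i) e, fun R hR => by
      rw [Pi.pow_apply, remForm_eq_zero_of_dvd hR, zero_pow he]⟩
  rw [hbot, Submodule.mem_bot] at hmem
  exact pow_ne_zero e hP (congrFun hmem P)

theorem mainTheorem4 (n j : ℕ) (hj : Odd j) (h1 : 1 < j) (h2 : j ≤ 2 * n + 1) :
    (∀ P : SymW n, (hessTrace j (P : PolyW n)).IsHomogeneous (j * (n - 2))) ∧
    (∀ (P : SymW n) (hP : P ≠ 0), Projectivization.mk ℂ P hP ∈ detOrbitClosure n →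
      (P : PolyW n) ∣ hessTrace j (P : PolyW n)) ∧
    (2 ≤ n → ∃ M : Submodule ℂ (SymW n → ℂ),
      M ≠ ⊥ ∧
      M ≤ polyForms (SymW n) ((j - 1) * (n - 1)) ∧
      (∀ (g : orthW n), ∀ F ∈ M, (fun P => F (symRep n g P)) ∈ M) ∧
      (∀ F ∈ M, ∀ (P : SymW n) (hP : P ≠ 0),
        Projectivization.mk ℂ P hP ∈ detOrbitClosure n → F P = 0) ∧
      (3 ≤ n → ∀ F ∈ M, ∀ P : SymW n,
        (P : PolyW n) ∣ hessTrace j (P : PolyW n) → F P = 0)) := by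
  have hn : n ≠ 0 := by omega
  refine ⟨fun P => hessTrace_isHomogeneous j n P.2,
    fun P hP => dvd_hessTrace_of_mem_detOrbitClosure hn hj hP, fun hn2 => ?_⟩
  obtain rfl | hn3 := hn2.eq_or_lt
  -- For `n = 2` the Hessian trace with index `1` is a linear form in `P`; its power `j - 1` has the
  -- required degree.
  · refine ⟨hessEquations 2 1 ((j - 1) * (2 - 1)), ?_, fun F hF => hF.1,
      fun g F hF => symRep_mem_hessEquations g hF, fun F hF P hP hmem =>
        hF.2 P (dvd_hessTrace_of_mem_detOrbitClosure hn odd_one hP hmem), fun h => ?_⟩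
    · exact hessEquations_ne_bot (e := j - 1) le_rfl one_pos (by norm_num) (by omega) (by simp)
    · omega
  · refine ⟨hessEquations n j ((j - 1) * (n - 1)), ?_, fun F hF => hF.1,
      fun g F hF => symRep_mem_hessEquations g hF, fun F hF P hP hmem =>
        hF.2 P (dvd_hessTrace_of_mem_detOrbitClosure hn hj hP hmem), fun _ F hF => hF.2⟩
    -- The bound on `j` enters here: `2n + 1 ≤ n²` for `n ≥ 3`, so there are at least `j` variables.
    refine hessEquations_ne_bot (e := 1) hn2 (by omega) (by nlinarith) one_ne_zero ?_
    -- With `n ≥ 3` and `j ≥ 3` the subtraction in the number of steps does not truncate.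
    obtain ⟨m, rfl⟩ : ∃ m, n = m + 3 := Nat.exists_eq_add_of_le' hn3
    obtain ⟨l, rfl⟩ : ∃ l, j = l + 3 := Nat.exists_eq_add_of_le' (by
      obtain ⟨a, rfl⟩ := hj
      omega)
    rw [mul_one, show (l + 3) * (m + 3 - 2) + 1 = l * (m + 1) + 2 * m + 1 + (m + 3) by
      rw [show m + 3 - 2 = m + 1 by omega]
      ring, Nat.add_sub_cancel, show l + 3 - 1 = l + 2 by omega, show m + 3 - 1 = m + 2 by omega]
    ring
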